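/- Let ${}^\omega 2$ be the Cantor space. A $(2,2)$-tree is a set $T\subseteq\bigcup_{n<\omega}({}^n2\times{}^n2)$ closed under restriction to smaller lengths, and $\lim T=\{(\eta,\nu)\in{}^\omega2\times{}^\omega2:(\eta\restriction n,\nu\restriction n)\in T\text{ for all }n<\omega\}$. For a cardinal $\kappa$, a $\kappa$-square is a set of the form $A\times A$ with $A\subseteq{}^\omega2$ and $|A|=\kappa$. Assume Martin's Axiom (for every nonempty c.c.c. forcing notion and every family of fewer than $2^{\aleph_0}$ dense subsets there is a filter meeting all of them). Let $\lambda<2^{\aleph_0}$ and $\mu$ be cardinals and let $F:\lambda\times\lambda\to\omega$ be symmetric, such that $(*)_{\lambda,\mu,F}$: there is no symmetric function $F':\mu\times\mu\to\omega$ with the property that for every $n<\omega$ and all pairwise distinct $\beta_0,\dots,\beta_{n-1}<\mu$ there are pairwise distinct $\alpha_0,\dots,\alpha_{n-1}<\lambda$ with $F'(\beta_k,\beta_l)=F(\alpha_k,\alpha_l)$ for all $k<l<n$. Then there is a Borel set $B\subseteq{}^\omega2\times{}^\omega2$ of the form $B=\bigcup_{n<\omega}\lim T_n$ with $(2,2)$-trees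 $T_n$ (so that each $\lim T_n$ is closed and $B$ is $F_\sigma$) which contains a $\lambda$-square but no $\mu$-square. -/

import Mathlib

open scoped Cardinal

/-- A forcing notion `P` (smaller conditions are stronger) satisfies the countable chain condition:
every set of pairwise incompatible conditions is countable. -/
def ForcingCCC (P : Type) [Preorder P] : Prop :=
  ∀ A : Set P, (∀ p ∈ A, ∀ q ∈ A, p ≠ q → ¬ ∃ r : P, r ≤ p ∧ r ≤ q) → A.Countable

/-- `D` is dense in the forcing notion `P`. -/
def ForcingDense {P : Type} [Preorder P] (D : Set P) : Prop :=
  ∀ p : P, ∃ d ∈ D, d ≤ p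

/-- Martin's Axiom: for every nonempty c.c.c. forcing notion and every family of fewer than
continuum many dense subsets there is a filter that meets every member of the family. -/
def MartinsAxiom : Prop :=
  ∀ (P : Type) [Preorder P] [Nonempty P], ForcingCCC P →
    ∀ 𝒟 : Set (Set P), #𝒟 < 𝔠 → (∀ D ∈ 𝒟, ForcingDense D) →
      ∃ G : Order.PFilter P, ∀ D ∈ 𝒟, ∃ p ∈ D, p ∈ G

/-- The set of reals `ω2`, with the product topology. -/
abbrev Reals2 : Type := ℕ → Bool

/-- `η ↾ n`, a member of `ⁿ2`. -/
def Reals2.restrict (η : Reals2) (n : ℕ) : Fin n → Bool := fun i => η i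

/-- A `(2,2)`-tree: a subset of `⋃ₙ ⁿ2 × ⁿ2` (given level by level) that is closed under
restriction to a smaller length. -/
structure TwoTwoTree where
  level : (n : ℕ) → Set ((Fin n → Bool) × (Fin n → Bool))
  restrict_mem : ∀ {m n : ℕ} (h : m ≤ n) {η ν : Fin n → Bool}, (η, ν) ∈ level n →
    (η ∘ Fin.castLE h, ν ∘ Fin.castLE h) ∈ level m

/-- `lim T`, the set of pairs of reals all of whose restrictions to a common length are in `T`. -/
def TwoTwoTree.lim (T : TwoTwoTree) : Set (Reals2 × Reals2) :=
  {x | ∀ n : ℕ, (x.1.restrict n, x.2.restrict n) ∈ T.level n}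

/-- `B` contains a `κ`-square: a set of the form `A × A` where `A` is a set of reals of
cardinality `κ`. -/
def ContainsSquare (κ : Cardinal.{0}) (B : Set (Reals2 × Reals2)) : Prop :=
  ∃ A : Set Reals2, #A = κ ∧ A ×ˢ A ⊆ B

/-- Every finite pattern of the colouring `F'` of pairs from `M` occurs in the colouring `F` of
pairs from `L`: for all pairwise distinct `β₀, …, βₙ₋₁` in `M` there are pairwise distinct
`α₀, …, αₙ₋₁` in `L` with `F'(βₖ, βₗ) = F(αₖ, αₗ)` for all `k < l < n`. -/
def FinitePatternsOccur {L M : Type} (F' : M → M → ℕ) (F : L → L → ℕ) : Prop :=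
  ∀ (n : ℕ) (β : Fin n → M), Function.Injective β →
    ∃ α : Fin n → L, Function.Injective α ∧ ∀ k l : Fin n, k < l → F' (β k) (β l) = F (α k) (α l)

/-- The property `(*)` of the cardinals `lam`, `mu` and of the 2-place function `F` from `lam`
to `ω`: there is no symmetric 2-place function from `mu` to `ω` all of whose finite patterns
occur in `F`. -/
def PatternStar (lam mu : Cardinal.{0}) (F : lam.ord.ToType → lam.ord.ToType → ℕ) : Prop :=
  ¬ ∃ F' : mu.ord.ToType → mu.ord.ToType → ℕ,
    (∀ a b, F' a b = F' b a) ∧ FinitePatternsOccur F' F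

/-! Force, by finite approximations, reals `η a` for `a < λ` and indices `k a b` coding `F a b`; let
`T m` be the tree generated by the pairs `(η a, η b)` of index `m`. The union of the `lim (T m)`
contains the square of the range of `η`. The order allows a new pair to take an index below the old
length `n` only if, up to `n`, it copies an old pair of that index. So a condition of length `n` in
the generic filter already decides `T m` up to level `n` for every `m < n`, using only its finite
support. Hence finitely many reals of a square inside the union, truncated far enough, are copies of
distinct elements of `λ` with the same colours, and a `μ`-square would yield the `F'` excluded by
`PatternStar`. Martin's Axiom applies by `SquareCond.ccc`, which rests on the amalgamation
`exists_le_of_reflects`, and by `SquareCond.forcingDense`. -/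

/-- A finite approximation to a family of reals `η a` and an index function `k` refining the
colouring `F`: on the finite set `u`, the reals are approximated, injectively, up to length `n`. -/
structure SquareCond {L : Type} (F : L → L → ℕ) where
  u : Finset L
  n : ℕ
  η : L → ℕ → Bool
  k : L → L → ℕ
  inj : ∀ a ∈ u, ∀ b ∈ u, (∀ i < n, η a i = η b i) → a = b
  col : ∀ a ∈ u, ∀ b ∈ u, (Nat.unpair (k a b)).1 = F a b

/-! ### The forcing notion and amalgamation of conditions. -/

namespace SquareCond

variable {L : Type} {F : L → L → ℕ}

/-- Every pair from `q` with index below `p.n` looks, up to length `p.n`, like a pair from `p`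
with the same index. -/
def Reflects (p q : SquareCond F) : Prop :=
  ∀ a ∈ q.u, ∀ b ∈ q.u, q.k a b < p.n → ∃ a' ∈ p.u, ∃ b' ∈ p.u, p.k a' b' = q.k a b ∧
    (∀ i < p.n, q.η a i = p.η a' i) ∧ ∀ i < p.n, q.η b i = p.η b' i

instance : Preorder (SquareCond F) where
  le q p := p.u ⊆ q.u ∧ p.n ≤ q.n ∧ (∀ a ∈ p.u, ∀ i < p.n, q.η a i = p.η a i) ∧
    (∀ a ∈ p.u, ∀ b ∈ p.u, q.k a b = p.k a b) ∧ p.Reflects q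
  le_refl p := ⟨subset_rfl, le_rfl, fun _ _ _ _ => rfl, fun _ _ _ _ => rfl,
    fun a ha b hb _ => ⟨a, ha, b, hb, rfl, fun _ _ => rfl, fun _ _ => rfl⟩⟩
  le_trans r q p := by
    rintro ⟨hu, hn, hη, hk, hr⟩ ⟨hu', hn', hη', hk', hr'⟩
    refine ⟨hu'.trans hu, hn'.trans hn, fun a ha i hi => ?_, fun a ha b hb => ?_, ?_⟩
    · rw [hη a (hu' ha) i (hi.trans_le hn'), hη' a ha i hi]
    · rw [hk a (hu' ha) b (hu' hb), hk' a ha b hb]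
    · intro a ha b hb hab
      obtain ⟨a₁, ha₁, b₁, hb₁, hk₁, hηa, hηb⟩ := hr a ha b hb (hab.trans_le hn')
      obtain ⟨a₂, ha₂, b₂, hb₂, hk₂, hηa', hηb'⟩ := hr' a₁ ha₁ b₁ hb₁ (hk₁ ▸ hab)
      exact ⟨a₂, ha₂, b₂, hb₂, hk₂.trans hk₁,
        fun i hi => (hηa i (hi.trans_le hn')).trans (hηa' i hi),
        fun i hi => (hηb i (hi.trans_le hn')).trans (hηb' i hi)⟩

instance : Nonempty (SquareCond F) :=
  ⟨⟨∅, 0, fun _ _ => false, fun _ _ => 0, by simp, by simp⟩⟩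

-- The new bit at place `p.n` separates `p.u` from the rest of `q.u`, where truncations may
-- coincide. Pairs across the two supports get an index that is at least `p.n`, hence exempt from
-- reflection.
open Classical in
theorem exists_le_of_reflects {p q : SquareCond F} (hn : p.n = q.n)
    (hη : ∀ a ∈ p.u, a ∈ q.u → ∀ i < p.n, p.η a i = q.η a i)
    (hk : ∀ a ∈ p.u, a ∈ q.u → ∀ b ∈ p.u, b ∈ q.u → p.k a b = q.k a b)
    (hpq : p.Reflects q) (hqp : q.Reflects p) : ∃ r : SquareCond F, r ≤ p ∧ r ≤ q := by
  let η : L → ℕ → Bool := fun a i =>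
    if i < p.n then if a ∈ p.u then p.η a i else q.η a i else decide (a ∉ p.u)
  let k : L → L → ℕ := fun a b =>
    if a ∈ p.u ∧ b ∈ p.u then p.k a b else
      if a ∈ q.u ∧ b ∈ q.u then q.k a b else Nat.pair (F a b) p.n
  have ηp : ∀ a ∈ p.u, ∀ i < p.n, η a i = p.η a i := fun a ha i hi => by simp [η, ha, hi]
  have ηq : ∀ a ∈ q.u, ∀ i < p.n, η a i = q.η a i := fun a ha i hi => by
    by_cases hap : a ∈ p.u
    · rw [ηp a hap i hi, hη a hap ha i hi]
    · simp [η, hap, hi]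
  have kp : ∀ a ∈ p.u, ∀ b ∈ p.u, k a b = p.k a b := fun a ha b hb => by simp [k, ha, hb]
  have kq : ∀ a ∈ q.u, ∀ b ∈ q.u, k a b = q.k a b := fun a ha b hb => by
    by_cases hab : a ∈ p.u ∧ b ∈ p.u
    · rw [kp a hab.1 b hab.2, hk a hab.1 ha b hab.2 hb]
    · simp only [k, if_neg hab, if_pos (And.intro ha hb)]
  have kcases : ∀ a b, (a ∈ p.u ∧ b ∈ p.u) ∨ (a ∈ q.u ∧ b ∈ q.u) ∨
      k a b = Nat.pair (F a b) p.n := fun a b => by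
    by_cases h₁ : a ∈ p.u ∧ b ∈ p.u
    · exact .inl h₁
    by_cases h₂ : a ∈ q.u ∧ b ∈ q.u
    · exact .inr (.inl h₂)
    · exact .inr (.inr (by simp only [k, if_neg h₁, if_neg h₂]))
  let r : SquareCond F :=
    { u := p.u ∪ q.u
      n := p.n + 1
      η := η
      k := k
      inj := by
        intro a ha b hb hab
        have hlast : a ∈ p.u ↔ b ∈ p.u := by
          have := hab p.n (Nat.lt_succ_self _)
          simpa [η] using this
        by_cases hap : a ∈ p.u
        · have hbp := hlast.1 hap
          refine p.inj a hap b hbp fun i hi => ?_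
          rw [← ηp a hap i hi, ← ηp b hbp i hi, hab i (by omega)]
        · have haq := (Finset.mem_union.1 ha).resolve_left hap
          have hbq := (Finset.mem_union.1 hb).resolve_left (mt hlast.2 hap)
          refine q.inj a haq b hbq fun i hi => ?_
          rw [← ηq a haq i (by omega), ← ηq b hbq i (by omega), hab i (by omega)]
      col := by
        intro a _ b _
        rcases kcases a b with h | h | h
        · rw [kp a h.1 b h.2, p.col a h.1 b h.2]
        · rw [kq a h.1 b h.2, q.col a h.1 b h.2]
        · rw [h, Nat.unpair_pair] }
  refine ⟨r, ⟨Finset.subset_union_left, Nat.le_succ _, ηp, kp, ?_⟩,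
    ⟨Finset.subset_union_right, hn ▸ Nat.le_succ _, hn ▸ ηq, kq, ?_⟩⟩
  · intro a _ b _ hab
    change k a b < p.n at hab
    change ∃ a' ∈ p.u, ∃ b' ∈ p.u, p.k a' b' = k a b ∧
      (∀ i < p.n, η a i = p.η a' i) ∧ ∀ i < p.n, η b i = p.η b' i
    rcases kcases a b with h | h | h
    · exact ⟨a, h.1, b, h.2, (kp a h.1 b h.2).symm, ηp a h.1, ηp b h.2⟩
    · rw [kq a h.1 b h.2] at hab ⊢
      obtain ⟨a', ha', b', hb', hk', h₁, h₂⟩ := hpq a h.1 b h.2 hab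
      exact ⟨a', ha', b', hb', hk', fun i hi => (ηq a h.1 i hi).trans (h₁ i hi),
        fun i hi => (ηq b h.2 i hi).trans (h₂ i hi)⟩
    · have := Nat.right_le_pair (F a b) p.n
      omega
  · intro a _ b _ hab
    change k a b < q.n at hab
    change ∃ a' ∈ q.u, ∃ b' ∈ q.u, q.k a' b' = k a b ∧
      (∀ i < q.n, η a i = q.η a' i) ∧ ∀ i < q.n, η b i = q.η b' i
    rcases kcases a b with h | h | h
    · rw [kp a h.1 b h.2] at hab ⊢
      obtain ⟨a', ha', b', hb', hk', h₁, h₂⟩ := hqp a h.1 b h.2 hab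
      exact ⟨a', ha', b', hb', hk', fun i hi => (ηp a h.1 i (hn ▸ hi)).trans (h₁ i hi),
        fun i hi => (ηp b h.2 i (hn ▸ hi)).trans (h₂ i hi)⟩
    · exact ⟨a, h.1, b, h.2, (kq a h.1 b h.2).symm, fun i hi => ηq a h.1 i (hn ▸ hi),
        fun i hi => ηq b h.2 i (hn ▸ hi)⟩
    · have := Nat.right_le_pair (F a b) p.n
      omega

/-! ### The countable chain condition. -/

theorem map_range_eq_iff {f g : ℕ → Bool} {n : ℕ} :
    (List.range n).map f = (List.range n).map g ↔ ∀ i < n, f i = g i := by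
  simp [List.map_inj_left]

theorem exists_separating_length {ι : Type*} {x : ι → ℕ → Bool} (hx : Function.Injective x)
    (s : Finset ι) : ∃ m, ∀ a ∈ s, ∀ b ∈ s, (∀ i < m, x a i = x b i) → a = b := by
  have h : ∀ c : ι × ι, ∃ m, c.1 ≠ c.2 → ∃ i < m, x c.1 i ≠ x c.2 i := fun c => by
    by_cases hc : c.1 = c.2
    · exact ⟨0, fun h => (h hc).elim⟩
    · obtain ⟨i, hi⟩ := Function.ne_iff.1 (hx.ne hc)
      exact ⟨i + 1, fun _ => ⟨i, i.lt_succ_self, hi⟩⟩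
  choose m hm using h
  refine ⟨(s ×ˢ s).sup m, fun a ha b hb hab => by_contra fun hne => ?_⟩
  obtain ⟨i, hi, hne'⟩ := hm (a, b) hne
  exact hne' (hab i (hi.trans_le (Finset.le_sup (f := m) (Finset.mk_mem_product ha hb))))

/-- The pairs from a condition, seen through an embedding `e` of the index set into the reals
truncated to length `m`. -/
def trace (e : L → ℕ → Bool) (m : ℕ) (p : SquareCond F) :
    Finset ((List Bool × List Bool) × (List Bool × List Bool) × ℕ) :=
  (p.u ×ˢ p.u).image fun c => (((List.range m).map (e c.1), (List.range m).map (e c.2)),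
    ((List.range p.n).map (p.η c.1), (List.range p.n).map (p.η c.2)), p.k c.1 c.2)

theorem exists_of_trace_eq {e : L → ℕ → Bool} {m : ℕ} {p q : SquareCond F} (hn : p.n = q.n)
    (h : p.trace e m = q.trace e m) {a b : L} (ha : a ∈ p.u) (hb : b ∈ p.u) :
    ∃ a' ∈ q.u, ∃ b' ∈ q.u, q.k a' b' = p.k a b ∧
      (∀ i < m, e a i = e a' i) ∧ (∀ i < m, e b i = e b' i) ∧
      (∀ i < q.n, p.η a i = q.η a' i) ∧ ∀ i < q.n, p.η b i = q.η b' i := by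
  have hmem : _ ∈ p.trace e m := Finset.mem_image_of_mem _ (Finset.mk_mem_product ha hb)
  rw [h] at hmem
  obtain ⟨⟨a', b'⟩, hab, heq⟩ := Finset.mem_image.1 hmem
  obtain ⟨ha', hb'⟩ := Finset.mem_product.1 hab
  simp only [Prod.mk.injEq, hn, map_range_eq_iff] at heq
  obtain ⟨⟨h₁, h₂⟩, ⟨h₃, h₄⟩, h₅⟩ := heq
  exact ⟨a', ha', b', hb', h₅, fun i hi => (h₁ i hi).symm, fun i hi => (h₂ i hi).symm,
    fun i hi => (h₃ i hi).symm, fun i hi => (h₄ i hi).symm⟩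

/-- A common element `a` has a partner in `q.u` with the same `e`-truncation, which is `a` itself by
separation; so the conditions agree on the common support. Equal traces also give reflection both
ways. -/
theorem exists_le_of_trace_eq {e : L → ℕ → Bool} {m : ℕ} {p q : SquareCond F}
    (hm : ∀ a ∈ q.u, ∀ b ∈ q.u, (∀ i < m, e a i = e b i) → a = b) (hn : p.n = q.n)
    (h : p.trace e m = q.trace e m) : ∃ r : SquareCond F, r ≤ p ∧ r ≤ q := by
  refine exists_le_of_reflects hn ?_ ?_ ?_ ?_
  · intro a ha haq i hi
    obtain ⟨a', ha', b', hb', -, h₁, -, h₃, -⟩ := exists_of_trace_eq hn h ha ha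
    rw [hm a haq a' ha' h₁, ← hm a haq a' ha' h₁, h₃ i (hn ▸ hi), ← hm a haq a' ha' h₁]
  · intro a ha haq b hb hbq
    obtain ⟨a', ha', b', hb', h₀, h₁, h₂, -, -⟩ := exists_of_trace_eq hn h ha hb
    rw [← h₀, hm a haq a' ha' h₁, hm b hbq b' hb' h₂]
  · intro a ha b hb _
    obtain ⟨a', ha', b', hb', h₀, -, -, h₃, h₄⟩ := exists_of_trace_eq hn.symm h.symm ha hb
    exact ⟨a', ha', b', hb', h₀, h₃, h₄⟩
  · intro a ha b hb _
    obtain ⟨a', ha', b', hb', h₀, -, -, h₃, h₄⟩ := exists_of_trace_eq hn h ha hb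
    exact ⟨a', ha', b', hb', h₀, h₃, h₄⟩

/-- Conditions are sorted by countably many codes, and those with the same code are compatible, so
no Δ-system argument is needed. -/
theorem ccc {e : L → ℕ → Bool} (he : Function.Injective e) : ForcingCCC (SquareCond F) := by
  intro A hA
  choose m hm using fun p : SquareCond F => exists_separating_length he p.u
  refine Set.MapsTo.countable_of_injOn (t := Set.univ)
    (f := fun p : SquareCond F => (p.n, m p, p.trace e (m p))) (Set.mapsTo_univ _ _) ?_
    Set.countable_univ
  intro p hp q hq hpq
  simp only [Prod.mk.injEq] at hpq
  obtain ⟨hn, hmm, ht⟩ := hpq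
  by_contra hne
  exact hA p hp q hq hne (exists_le_of_trace_eq (hm q) hn (hmm ▸ ht))

-- The case `none` only lengthens the condition, which makes sense even for empty `L`.
open Classical in
theorem forcingDense (o : Option L) (i : ℕ) :
    ForcingDense {p : SquareCond F | (∀ a ∈ o, a ∈ p.u) ∧ i < p.n} := by
  intro p
  let η : L → ℕ → Bool := fun a j => if j < p.n then p.η a j else decide (a ∉ p.u)
  let k : L → L → ℕ := fun a b =>
    if a ∈ p.u ∧ b ∈ p.u then p.k a b else Nat.pair (F a b) p.n
  have kp : ∀ a ∈ p.u, ∀ b ∈ p.u, k a b = p.k a b := fun a ha b hb => by simp [k, ha, hb]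
  have kcases : ∀ a b, (a ∈ p.u ∧ b ∈ p.u) ∨ k a b = Nat.pair (F a b) p.n := fun a b => by
    by_cases h : a ∈ p.u ∧ b ∈ p.u
    · exact .inl h
    · exact .inr (by simp only [k, if_neg h])
  have ηp : ∀ a, ∀ j < p.n, η a j = p.η a j := fun a j hj => by simp [η, hj]
  let r : SquareCond F :=
    { u := p.u ∪ o.toFinset
      n := p.n + i + 1
      η := η
      k := k
      inj := by
        intro a ha b hb hab
        have hlast : a ∈ p.u ↔ b ∈ p.u := by
          have := hab p.n (by omega)
          simpa [η] using this
        by_cases hap : a ∈ p.u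
        · refine p.inj a hap b (hlast.1 hap) fun j hj => ?_
          rw [← ηp a j hj, ← ηp b j hj, hab j (by omega)]
        · have hao := Option.mem_toFinset.1 ((Finset.mem_union.1 ha).resolve_left hap)
          have hbo := Option.mem_toFinset.1
            ((Finset.mem_union.1 hb).resolve_left (mt hlast.2 hap))
          exact Option.mem_unique hao hbo
      col := by
        intro a _ b _
        rcases kcases a b with h | h
        · rw [kp a h.1 b h.2, p.col a h.1 b h.2]
        · rw [h, Nat.unpair_pair] }
  refine ⟨r, ⟨fun a ha => Finset.mem_union_right _ (Option.mem_toFinset.2 ha), ?_⟩,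
    Finset.subset_union_left, ?_, fun a _ => ηp a, kp, ?_⟩
  · change i < p.n + i + 1
    omega
  · change p.n ≤ p.n + i + 1
    omega
  · intro a _ b _ hab
    change k a b < p.n at hab
    rcases kcases a b with h | h
    · exact ⟨a, h.1, b, h.2, (kp a h.1 b h.2).symm, ηp a, ηp b⟩
    · have := Nat.right_le_pair (F a b) p.n
      omega

end SquareCond

/-! ### The generic family of reals. -/

/-- What Martin's Axiom yields: reals `η a` with an index function `k` refining `F`, such that
for arbitrarily large `n` the pairs of index below `n` are, up to length `n`, pairs from a finite
set on which the truncations of the reals to length `n` are distinct. -/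
theorem exists_generic_family (hMA : MartinsAxiom) {L : Type} (hL : #L < 𝔠) (F : L → L → ℕ) :
    ∃ (η : L → Reals2) (k : L → L → ℕ), Function.Injective η ∧
      ∀ N : ℕ, ∃ p : SquareCond F, N < p.n ∧
        ∀ a b, k a b < p.n → ∃ a' ∈ p.u, ∃ b' ∈ p.u, p.k a' b' = k a b ∧
          (∀ i < p.n, η a i = p.η a' i) ∧ ∀ i < p.n, η b i = p.η b' i := by
  obtain ⟨e⟩ : Nonempty (L ↪ Reals2) := by
    rw [← Cardinal.le_def]
    simpa using hL.le
  have hcard : #(Set.range fun c : Option L × ℕ =>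
      {p : SquareCond F | (∀ a ∈ c.1, a ∈ p.u) ∧ c.2 < p.n}) < 𝔠 := by
    refine Cardinal.mk_range_le.trans_lt ?_
    rw [Cardinal.mk_prod, Cardinal.mk_option]
    simp only [Cardinal.lift_id, Cardinal.mk_nat]
    have hc := Cardinal.aleph0_le_continuum
    exact Cardinal.mul_lt_of_lt hc
      (Cardinal.add_lt_of_lt hc hL (Cardinal.one_lt_aleph0.trans_le hc))
      Cardinal.aleph0_lt_continuum
  obtain ⟨G, hG⟩ := hMA (SquareCond F) (SquareCond.ccc e.injective) _ hcard (by
    rintro _ ⟨c, rfl⟩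
    exact SquareCond.forcingDense c.1 c.2)
  have hG' : ∀ (o : Option L) (i : ℕ), ∃ p ∈ G, (∀ a ∈ o, a ∈ p.u) ∧ i < p.n := fun o i => by
    obtain ⟨p, hp, hpG⟩ := hG _ ⟨(o, i), rfl⟩
    exact ⟨p, hpG, hp⟩
  have hdir : ∀ p ∈ G, ∀ q ∈ G, ∃ r ∈ G, r ≤ p ∧ r ≤ q := fun p hp q hq => G.directed p hp q hq
  choose P hPG hPu hPn using fun (a : L) (i : ℕ) => hG' (some a) i
  have hQ : ∀ a b : L, ∃ p ∈ G, a ∈ p.u ∧ b ∈ p.u := fun a b => by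
    obtain ⟨r, hr, ha, hb⟩ := hdir _ (hPG a 0) _ (hPG b 0)
    exact ⟨r, hr, ha.1 (hPu a 0 a rfl), hb.1 (hPu b 0 b rfl)⟩
  choose Q hQG hQa hQb using hQ
  -- The value does not depend on the chosen condition, since members of the filter have common
  -- extensions.
  have hη : ∀ p ∈ G, ∀ a ∈ p.u, ∀ i < p.n, (P a i).η a i = p.η a i := fun p hp a ha i hi => by
    obtain ⟨r, -, h₁, h₂⟩ := hdir _ (hPG a i) p hp
    rw [← h₁.2.2.1 a (hPu a i a rfl) i (hPn a i), h₂.2.2.1 a ha i hi]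
  have hk : ∀ p ∈ G, ∀ a ∈ p.u, ∀ b ∈ p.u, (Q a b).k a b = p.k a b := fun p hp a ha b hb => by
    obtain ⟨r, -, h₁, h₂⟩ := hdir _ (hQG a b) p hp
    rw [← h₁.2.2.2.1 a (hQa a b) b (hQb a b), h₂.2.2.2.1 a ha b hb]
  refine ⟨fun a i => (P a i).η a i, fun a b => (Q a b).k a b, fun a b hab => ?_, fun N => ?_⟩
  · refine (Q a b).inj a (hQa a b) b (hQb a b) fun i hi => ?_
    rw [← hη _ (hQG a b) a (hQa a b) i hi, ← hη _ (hQG a b) b (hQb a b) i hi]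
    exact congrFun hab i
  · obtain ⟨p, hp, -, hpn⟩ := hG' none N
    refine ⟨p, hpn, fun a b hab => ?_⟩
    -- The pair `a`, `b` need not lie in `p.u`; it lies in the support of `r`, which `p` reflects.
    obtain ⟨r, hr, hrp, hrQ⟩ := hdir p hp _ (hQG a b)
    have ha := hrQ.1 (hQa a b)
    have hb := hrQ.1 (hQb a b)
    have hkr := hk r hr a ha b hb
    obtain ⟨a', ha', b', hb', h₀, h₁, h₂⟩ := hrp.2.2.2.2 a ha b hb (hkr ▸ hab)
    refine ⟨a', ha', b', hb', h₀.trans hkr.symm, fun i hi => ?_, fun i hi => ?_⟩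
    · rw [← h₁ i hi]
      exact hη r hr a ha i (hi.trans_le hrp.2.1)
    · rw [← h₂ i hi]
      exact hη r hr b hb i (hi.trans_le hrp.2.1)

/-! ### Trees, their closed limits, and the final argument. -/

namespace TwoTwoTree

theorem isClosed_lim (T : TwoTwoTree) : IsClosed T.lim := by
  have h : T.lim = ⋂ n, (fun x : Reals2 × Reals2 => (x.1.restrict n, x.2.restrict n)) ⁻¹'
      T.level n := by
    ext x
    simp [lim]
  rw [h]
  refine isClosed_iInter fun n => (isClosed_discrete _).preimage ?_
  unfold Reals2.restrict
  fun_prop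

/-- The tree of all restrictions of members of a set of pairs of reals. -/
def ofSet (E : Set (Reals2 × Reals2)) : TwoTwoTree where
  level n := (fun x => (x.1.restrict n, x.2.restrict n)) '' E
  restrict_mem := by
    rintro m n h η ν ⟨x, hx, heq⟩
    obtain ⟨rfl, rfl⟩ := Prod.mk.inj heq
    exact ⟨x, hx, rfl⟩

theorem subset_lim_ofSet (E : Set (Reals2 × Reals2)) : E ⊆ (ofSet E).lim :=
  fun x hx _ => ⟨x, hx, rfl⟩

theorem exists_of_mem_lim_ofSet {E : Set (Reals2 × Reals2)} {x : Reals2 × Reals2}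
    (hx : x ∈ (ofSet E).lim) (n : ℕ) :
    ∃ y ∈ E, (∀ i < n, y.1 i = x.1 i) ∧ ∀ i < n, y.2 i = x.2 i := by
  obtain ⟨y, hy, heq⟩ := hx n
  obtain ⟨h₁, h₂⟩ := Prod.mk.inj heq
  exact ⟨y, hy, fun i hi => congrFun h₁ ⟨i, hi⟩, fun i hi => congrFun h₂ ⟨i, hi⟩⟩

end TwoTwoTree

theorem claim3p7 (hMA : MartinsAxiom) (lam mu : Cardinal.{0}) (hlam : lam < 𝔠)
    (F : lam.ord.ToType → lam.ord.ToType → ℕ) (hF : ∀ a b, F a b = F b a)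
    (hstar : PatternStar lam mu F) :
    ∃ B : Set (Reals2 × Reals2),
      @MeasurableSet (Reals2 × Reals2) (borel (Reals2 × Reals2)) B ∧
      (∃ T : ℕ → TwoTwoTree, (∀ n, IsClosed (T n).lim) ∧ B = ⋃ n, (T n).lim) ∧
      ContainsSquare lam B ∧ ¬ ContainsSquare mu B := by
  obtain ⟨η, k, hη, hgen⟩ := exists_generic_family hMA (by simpa using hlam) F
  let T : ℕ → TwoTwoTree := fun m =>
    TwoTwoTree.ofSet {x | ∃ a b, k a b = m ∧ x = (η a, η b)}
  refine ⟨⋃ m, (T m).lim, ?_, ⟨T, fun m => (T m).isClosed_lim, rfl⟩, ?_, ?_⟩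
  · let _ : MeasurableSpace (Reals2 × Reals2) := borel _
    have _ : BorelSpace (Reals2 × Reals2) := ⟨rfl⟩
    exact MeasurableSet.iUnion fun m => (T m).isClosed_lim.measurableSet
  · refine ⟨Set.range η, by rw [Cardinal.mk_range_eq η hη]; simp, ?_⟩
    rintro ⟨_, _⟩ ⟨⟨a, rfl⟩, ⟨b, rfl⟩⟩
    exact Set.mem_iUnion.2 ⟨k a b, TwoTwoTree.subset_lim_ofSet _ ⟨a, b, rfl, rfl⟩⟩
  · rintro ⟨A, hA, hAB⟩
    obtain ⟨f⟩ : Nonempty (mu.ord.ToType ≃ A) := Cardinal.eq.1 (by simp [hA])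
    let x : mu.ord.ToType → Reals2 := fun a => f a
    have hx : Function.Injective x := Subtype.val_injective.comp f.injective
    -- Both orders are admitted because `k` need not be symmetric, whereas `F'` must be.
    let S : mu.ord.ToType → mu.ord.ToType → Set ℕ := fun a b =>
      {m | (x a, x b) ∈ (T m).lim ∨ (x b, x a) ∈ (T m).lim}
    have hSsymm : ∀ a b, S a b = S b a := fun a b => Set.ext fun m => or_comm
    have hS : ∀ a b, sInf (S a b) ∈ S a b := fun a b => Nat.sInf_mem (by
      obtain ⟨m, hm⟩ := Set.mem_iUnion.1 (hAB (Set.mk_mem_prod (f a).2 (f b).2))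
      exact ⟨m, .inl hm⟩)
    refine hstar ⟨fun a b => (Nat.unpair (sInf (S a b))).1, fun a b => by simp only [hSsymm a b], ?_⟩
    intro n β hβ
    obtain ⟨N, hN⟩ := SquareCond.exists_separating_length (hx.comp hβ) Finset.univ
    -- The length `p.n` exceeds both a length separating the reals `x (β i)` and every index used by
    -- their pairs.
    obtain ⟨p, hpn, hp⟩ := hgen (max N
      (Finset.univ.sup fun c : Fin n × Fin n => sInf (S (β c.1) (β c.2))))
    have hNp : N < p.n := (le_max_left _ _).trans_lt hpn
    have hSp : ∀ i j, sInf (S (β i) (β j)) < p.n := fun i j =>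
      ((Finset.le_sup (f := fun c : Fin n × Fin n => sInf (S (β c.1) (β c.2)))
        (Finset.mem_univ (i, j))).trans (le_max_right _ _)).trans_lt hpn
    have key : ∀ y z : Reals2, ∀ m < p.n, (y, z) ∈ (T m).lim → ∃ a ∈ p.u, ∃ b ∈ p.u,
        (Nat.unpair m).1 = F a b ∧ (∀ i < p.n, y i = p.η a i) ∧ ∀ i < p.n, z i = p.η b i := by
      intro y z m hm hyz
      -- A point of `lim (T m)` need not be a pair of generic reals, but its truncation to `p.n` is
      -- that of one with index `m`.
      obtain ⟨_, ⟨a, b, rfl, rfl⟩, h₁, h₂⟩ := TwoTwoTree.exists_of_mem_lim_ofSet hyz p.n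
      obtain ⟨a', ha', b', hb', h₀, h₃, h₄⟩ := hp a b hm
      exact ⟨a', ha', b', hb', h₀ ▸ p.col a' ha' b' hb',
        fun i hi => (h₁ i hi).symm.trans (h₃ i hi), fun i hi => (h₂ i hi).symm.trans (h₄ i hi)⟩
    -- The diagonal pair of `x (β i)` with itself also lies in the square, and it provides `α i`.
    have hα : ∀ i : Fin n, ∃ a ∈ p.u, ∀ j < p.n, x (β i) j = p.η a j := fun i => by
      rcases hS (β i) (β i) with h | h <;>
      · obtain ⟨a, ha, -, -, -, h', -⟩ := key _ _ _ (hSp i i) h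
        exact ⟨a, ha, h'⟩
    choose α hαu hα using hα
    refine ⟨α, fun i j hij => ?_, fun i j _ => ?_⟩
    · refine hN i (Finset.mem_univ _) j (Finset.mem_univ _) fun l hl => ?_
      exact (hα i l (hl.trans hNp)).trans (hij ▸ (hα j l (hl.trans hNp)).symm)
    -- Each pair yields its own witnesses in `p.u`; injectivity of the truncations in `p` identifies
    -- them with the `α l`.
    · have hα_eq : ∀ l, ∀ a ∈ p.u, (∀ i < p.n, x (β l) i = p.η a i) → a = α l :=
        fun l a ha h => p.inj a ha (α l) (hαu l) fun i hi => (h i hi).symm.trans (hα l i hi)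
      rcases hS (β i) (β j) with h | h
      · obtain ⟨a, ha, b, hb, hab, h₁, h₂⟩ := key _ _ _ (hSp i j) h
        rw [← hα_eq i a ha h₁, ← hα_eq j b hb h₂]
        exact hab
      · obtain ⟨a, ha, b, hb, hab, h₁, h₂⟩ := key _ _ _ (hSp i j) h
        rw [← hα_eq j a ha h₁, ← hα_eq i b hb h₂, hF]
        exact hab
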